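/- Let $1\le p<\infty$ and let $(w_t)_{t\ge 0}$ be a sequence of positive real numbers. On a measure space $(X,\mu)$ put $\|g\|_{p,\infty}=\sup_{y>0}\,y\,\mu\{x: |g(x)|\ge y\}^{1/p}$, and define $$C_1(w)=\sup_{y>0}\ \sum_{t:\ y<w_t<2^t y} w_t,\qquad C_p(w)=\|w\|_{p,\infty}=\sup_{y>0}\, y\,\#\{t: w_t\ge y\}^{1/p}\quad(1<p<\infty).$$ Assume that $C_p(w)=\infty$. Let $(X,\mu)$ be a probability space whose points are separated by countably many measurable sets (for example a standard Borel or Lebesgue space), and let $T:X\to X$ be a measure-preserving transformation (not necessarily invertible) which is aperiodic, i.e. for almost every $x$ one has $T^nx\ne x$ for all $n\ge 1$. For a sequence $(a_n)_{n\ge1}$ of non-negative integers consider the averages $$w_tA_tf(x)=w_t2^{-t}\sum_{n=1}^{2^t} f(T^{a_n}x).$$ Then there is a sequence $(a_n)$ of non-negative integers such that 1. the maximal function is not weak $(p,p)$: there is no constant $C>0$ with $\|\sup_t w_tA_tf\|_{p,\infty}\le C\|f\|_p$ for all $f\in L^p(\mu)$; and 2. there is an $f\in L^p(\mu)$ for which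 the averages diverge almost everywhere, in the sense that $\limsup_{t\to\infty} w_tA_tf(x)=+\infty$ for almost every $x$. Moreover, both assertions hold for the sequence $a_n=n!$, whatever $p$, $w$ and $T$ are. -/

import Mathlib

open MeasureTheory Filter
open scoped ENNReal NNReal

noncomputable section

/-- The weak `L^{p,∞}` quasi-norm `sup_y y * μ {x | |f x| ≥ y} ^ (1/p)`, as a functional of `g = |f|`. -/
def weakLpNorm {α : Type*} [MeasurableSpace α] (μ : Measure α) (p : ℝ) (g : α → ℝ≥0∞) : ℝ≥0∞ :=
  ⨆ y : ℝ≥0, (y : ℝ≥0∞) * μ {x | (y : ℝ≥0∞) ≤ g x} ^ (1 / p)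

open Classical in
/-- The quantity `C_p(w)`: it is `sup_y ∑_t [y < w_t < 2^t y] w_t` for `p = 1`, and the weak
`ℓ^{p,∞}` norm of `w` (with respect to the counting measure) for `p > 1`. -/
def weightConst (p : ℝ) (w : ℕ → ℝ) : ℝ≥0∞ :=
  if p = 1 then
    ⨆ y : ℝ≥0, ∑' t : ℕ, if (y : ℝ) < w t ∧ w t < 2 ^ t * (y : ℝ) then ENNReal.ofReal (w t) else 0
  else weakLpNorm (Measure.count : Measure ℕ) p (fun t => ‖w t‖ₑ)

/-- A transformation is aperiodic if almost no point is periodic. -/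
def AperiodicTransformation {X : Type*} [MeasurableSpace X] (μ : Measure X) (T : X → X) : Prop :=
  ∀ᵐ x ∂μ, ∀ n : ℕ, 1 ≤ n → T^[n] x ≠ x

/-- The weighted average `w_t 2^{-t} ∑_{1 ≤ n ≤ 2^t} f (T^{a_n} x)`. -/
def weightedAverage {X : Type*} (T : X → X) (a : ℕ → ℕ) (w : ℕ → ℝ) (f : X → ℝ) (t : ℕ) (x : X) :
    ℝ :=
  w t * ((2 : ℝ) ^ t)⁻¹ * ∑ n ∈ Finset.Icc 1 (2 ^ t), f (T^[a n] x)

/-- The maximal function `sup_t w_t 2^{-t} ∑_{1 ≤ n ≤ 2^t} f (T^{a_n} x)`, possibly `+∞`. -/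
def maximalFunction {X : Type*} (T : X → X) (a : ℕ → ℕ) (w : ℕ → ℝ) (f : X → ℝ) (x : X) : EReal :=
  ⨆ t : ℕ, (weightedAverage T a w f t x : EReal)

/-- The weighted averages satisfy a weak `(p,p)` maximal inequality: there is `C > 0` such that
the weak `L^{p,∞}` norm of the maximal function is at most `C ‖f‖_p` for every `f ∈ L^p`. -/
def SatisfiesWeakMaximalInequality {X : Type*} [MeasurableSpace X] (μ : Measure X) (T : X → X)
    (a : ℕ → ℕ) (w : ℕ → ℝ) (p : ℝ) : Prop :=
  ∃ C : ℝ≥0, 0 < C ∧ ∀ f : X → ℝ, MemLp f (ENNReal.ofReal p) μ →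
    weakLpNorm μ p (fun x => (maximalFunction T a w f x).abs)
      ≤ (C : ℝ≥0∞) * eLpNorm f (ENNReal.ofReal p) μ

/-- For almost every `x` the weighted averages of `f` diverge at `x`, with limit superior `+∞`. -/
def DivergesAE {X : Type*} [MeasurableSpace X] (μ : Measure X) (T : X → X)
    (a : ℕ → ℕ) (w : ℕ → ℝ) (f : X → ℝ) : Prop :=
  ∀ᵐ x ∂μ, limsup (fun t : ℕ => (weightedAverage T a w f t x : EReal)) atTop = ⊤

end

/-! The core is a set `F` whose measure is small compared with `y ^ p`, while off a small
exceptional set some weighted average of its indicator is at least `y`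
(`exists_set_le_weightedAverage`).

The hypothesis on `w` yields a level `y` and finitely many scales `t` with lengths `r t`, where `r t
* y ≤ 2 * w t` and the total `R` is huge compared with `y ^ (-p)` (`exists_large_block_lengths`).
Cut the circle into `R` arcs and give each scale `t` a block of `r t` of them. Factorials grow so
fast that one rotation `α` makes `n! • α` close to the arc numbered `n % r t` in the block of `t`,
for all `n` in `(2^(t-1), 2^t]` (`exists_factorial_nsmul_approx`).

Rotation is transferred to `T` by a Rokhlin-type countdown `h` (`exists_countdown`): `h x • α + β`
moves by `-n! • α` under `T^[n!]`. Let `F` be the set where this phase is within `5 / R` of `0`; for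
a suitable `β` its measure is at most `10 / R`. The phase of `x` lies in an arc of some block `t`,
so a whole residue class of `n` modulo `r t` brings `x` into `F`, and the average is at least about
`w t / (4 * r t)`, hence `y / 8`.

Superposing such sets gives one `f` in `L^p` with almost everywhere divergence, which in turn rules
out the weak inequality. -/

/-! ### Aperiodicity: colourings, sweeping sets and countdowns -/

/-- The natural number whose binary digits are the first `K` terms of `u`. -/
def prefixCode (u : ℕ → Bool) : ℕ → ℕ
  | 0 => 0
  | K + 1 => 2 * prefixCode u K + (u K).toNat

lemma prefixCode_eq_imp {u v : ℕ → Bool} {K : ℕ} (h : prefixCode u K = prefixCode v K) :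
    ∀ k < K, u k = v k := by
  induction K with
  | zero => intro k hk; omega
  | succ K ih =>
    simp only [prefixCode] at h
    have h1 := Bool.toNat_le (u K)
    have h2 := Bool.toNat_le (v K)
    intro k hk
    rcases Nat.lt_succ_iff_lt_or_eq.mp hk with hk | rfl
    · exact ih (by omega) k hk
    · have h3 : (u k).toNat = (v k).toNat := by omega
      cases hu : u k <;> cases hv : v k <;> simp_all

lemma measurable_prefixCode {X : Type*} [MeasurableSpace X] {φ : X → ℕ → Bool}
    (hφ : Measurable φ) (K : ℕ) : Measurable fun x => prefixCode (φ x) K := by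
  induction K with
  | zero => exact measurable_const
  | succ K ih =>
    simp only [prefixCode]
    have h : Measurable fun x => (φ x K).toNat :=
      (Measurable.of_discrete (f := Bool.toNat)).comp ((measurable_pi_apply K).comp hφ)
    exact (ih.const_mul 2).add h

/-- An aperiodic transformation admits a measurable colouring with countably many colours which is
injective on almost every orbit segment of a given length. -/
lemma exists_measurable_coloring {X : Type*} [MeasurableSpace X]
    [MeasurableSpace.CountablySeparated X] {μ : Measure X} {T : X → X} (hT : Measurable T)
    (hap : AperiodicTransformation μ T) (n : ℕ) :
    ∃ v : X → ℕ, Measurable v ∧ ∀ᵐ x ∂μ, ∀ j, 1 ≤ j → j ≤ n → v (T^[j] x) ≠ v x := by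
  classical
  obtain ⟨φ, hφ, hinj⟩ := MeasurableSpace.measurable_injection_nat_bool_of_countablySeparated X
  let good : X → ℕ → Prop := fun x K =>
    ∀ j ∈ Finset.Icc 1 n, prefixCode (φ (T^[j] x)) K ≠ prefixCode (φ x) K
  have hgood : ∀ K, MeasurableSet {x | good x K} := by
    intro K
    simp only [good, Set.ofPred_forall]
    refine MeasurableSet.iInter fun j => MeasurableSet.iInter fun _ => ?_
    exact (measurableSet_eq_fun ((measurable_prefixCode hφ K).comp (hT.iterate j))
      (measurable_prefixCode hφ K)).compl
  -- The second alternative makes the search total: points with no separating prefix get `K = 0`.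
  have hex : ∀ x, ∃ K, good x K ∨ ∀ K', ¬ good x K' := by
    intro x
    by_cases h : ∃ K, good x K
    · exact h.imp fun K hK => Or.inl hK
    · exact ⟨0, Or.inr (not_exists.mp h)⟩
  have hK : Measurable fun x => Nat.find (hex x) := by
    refine measurable_find hex fun k => ?_
    have hbad : MeasurableSet {x | ∀ K', ¬ good x K'} := by
      rw [Set.ofPred_forall]
      exact MeasurableSet.iInter fun K' => (hgood K').compl
    exact (hgood k).union hbad
  have hc : Measurable fun x => prefixCode (φ x) (Nat.find (hex x)) :=
    (measurable_from_prod_countable_right (f := fun q : ℕ × X => prefixCode (φ q.2) q.1)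
      fun K => measurable_prefixCode hφ K).comp (hK.prodMk measurable_id)
  -- Storing `K` in the colour ensures that equal colours compare prefixes of the same length.
  refine ⟨fun x => Nat.pair (Nat.find (hex x)) (prefixCode (φ x) (Nat.find (hex x))),
    (Measurable.of_discrete (f := fun q : ℕ × ℕ => Nat.pair q.1 q.2)).comp (hK.prodMk hc), ?_⟩
  filter_upwards [hap] with x hx j hj1 hjn heq
  obtain ⟨hK', hc'⟩ := Nat.pair_eq_pair.mp heq
  have hsep : ∀ i ∈ Finset.Icc 1 n, ∃ k, φ (T^[i] x) k ≠ φ x k := fun i hi => by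
    by_contra! h
    exact hx i (Finset.mem_Icc.mp hi).1 (hinj (funext h))
  choose! k hk using hsep
  -- The sum plus one exceeds every index `k i` at which the codes differ.
  have hgx : good x (∑ i ∈ Finset.Icc 1 n, k i + 1) := fun i hi h =>
    hk i hi (prefixCode_eq_imp h (k i)
      (Nat.lt_succ_of_le (Finset.single_le_sum (fun _ _ => Nat.zero_le _) hi)))
  rcases Nat.find_spec (hex x) with h | h
  · rw [hK'] at hc'
    exact h j (Finset.mem_Icc.mpr ⟨hj1, hjn⟩) hc'
  · exact h _ hgx

/-- A measurable set of measure at most `1 / (n + 1)` which is met by every orbit. -/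
lemma exists_sweeping_set {X : Type*} [MeasurableSpace X]
    [MeasurableSpace.CountablySeparated X] {μ : Measure X} [IsProbabilityMeasure μ] {T : X → X}
    (hT : MeasurePreserving T μ μ) (hap : AperiodicTransformation μ T) (n : ℕ) :
    ∃ B : Set X, MeasurableSet B ∧ (n + 1 : ℝ≥0∞) * μ B ≤ 1 ∧ ∀ x, ∃ k, T^[k] x ∈ B := by
  obtain ⟨v, hv, hsep⟩ := exists_measurable_coloring hT.measurable hap n
  -- `B` consists of the points of minimal colour along their forward orbit; every orbit meets it
  -- because `ℕ` is well ordered.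
  have hB : MeasurableSet {x | ∀ k, v x ≤ v (T^[k] x)} := by
    rw [Set.ofPred_forall]
    exact MeasurableSet.iInter fun k =>
      measurableSet_le hv (hv.comp (hT.measurable.iterate k))
  refine ⟨{x | ∀ k, v x ≤ v (T^[k] x)}, hB, ?_, fun x => ?_⟩
  · set B := {x | ∀ k, v x ≤ v (T^[k] x)} with hBdef
    have hrec : ∀ᵐ x ∂μ, ∀ c, v x = c → ∃ᶠ m in atTop, v (T^[m] x) = c := by
      rw [ae_all_iff]
      intro c
      exact hT.conservative.ae_mem_imp_frequently_image_mem
        (hv (measurableSet_singleton c)).nullMeasurableSet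
    -- If `x` and `T^[j] x` both lie in `B`, Poincaré recurrence returns the colour of `x` after
    -- time `j`, so the two minima coincide, against the colouring.
    have hret : ∀ j, 1 ≤ j → j ≤ n → μ (B ∩ T^[j] ⁻¹' B) = 0 := by
      intro j hj1 hjn
      rw [measure_eq_zero_iff_ae_notMem]
      filter_upwards [hsep, hrec] with x h1 h2 hx
      obtain ⟨m, hm, hmx⟩ := (frequently_atTop.mp (h2 _ rfl)) j
      refine h1 j hj1 hjn (le_antisymm ?_ (hx.1 j))
      have h3 := hx.2 (m - j)
      rwa [← Function.iterate_add_apply, Nat.sub_add_cancel hm, hmx] at h3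
    have hdisj : (↑(Finset.range (n + 1)) : Set ℕ).Pairwise
        (Function.onFun (AEDisjoint μ) fun i => T^[i] ⁻¹' B) := by
      have key : ∀ i j, i < j → j ≤ n → μ (T^[i] ⁻¹' B ∩ T^[j] ⁻¹' B) = 0 := by
        intro i j hij hj
        have h : T^[i] ⁻¹' B ∩ T^[j] ⁻¹' B = T^[i] ⁻¹' (B ∩ T^[j - i] ⁻¹' B) := by
          ext x
          simp only [Set.mem_inter_iff, Set.mem_preimage, ← Function.iterate_add_apply,
            Nat.sub_add_cancel hij.le]
        rw [h, (hT.iterate i).measure_preimage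
          (hB.inter (hT.measurable.iterate _ hB)).nullMeasurableSet]
        exact hret _ (by omega) (by omega)
      intro i hi j hj hij
      simp only [Finset.coe_range, Set.mem_Iio] at hi hj
      rcases lt_or_gt_of_ne hij with h | h
      · exact key i j h (by omega)
      · exact AEDisjoint.symm (key j i h (by omega))
    calc (n + 1 : ℝ≥0∞) * μ B = ∑ i ∈ Finset.range (n + 1), μ (T^[i] ⁻¹' B) := by
          rw [Finset.sum_congr rfl fun i _ =>
            (hT.iterate i).measure_preimage hB.nullMeasurableSet]
          simp
      _ = μ (⋃ i ∈ Finset.range (n + 1), T^[i] ⁻¹' B) :=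
          (measure_biUnion_finset₀ hdisj
            fun i _ => (hT.measurable.iterate i hB).nullMeasurableSet).symm
      _ ≤ 1 := prob_le_one
  · obtain ⟨k, hk⟩ : ∃ k, ∀ m, v (T^[k] x) ≤ v (T^[m] x) :=
      ⟨_, fun m => Function.argmin_le (fun k => v (T^[k] x)) m⟩
    refine ⟨k, fun m => ?_⟩
    rw [← Function.iterate_add_apply]
    exact hk _

/-- A measurable integer-valued function which decreases by one along `m` steps of the orbit of
each point outside a set of small measure. -/
lemma exists_countdown {X : Type*} [MeasurableSpace X]
    [MeasurableSpace.CountablySeparated X] {μ : Measure X} [IsProbabilityMeasure μ] {T : X → X}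
    (hT : MeasurePreserving T μ μ) (hap : AperiodicTransformation μ T) (m : ℕ)
    {ε : ℝ≥0∞} (hε : ε ≠ 0) :
    ∃ h : X → ℕ, Measurable h ∧ ∃ E : Set X, μ E ≤ ε ∧
      ∀ x ∉ E, ∀ i ≤ m, h (T^[i] x) + i = h x := by
  classical
  obtain ⟨n, hn⟩ := ENNReal.exists_nat_gt (ENNReal.div_ne_top (ENNReal.natCast_ne_top m) hε)
  obtain ⟨B, hB, hμB, hhit⟩ := exists_sweeping_set hT hap n
  -- The countdown is the hitting time of `B`; the exceptional set holds the points that hit `B`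
  -- before time `m`.
  refine ⟨fun x => Nat.find (hhit x), measurable_find hhit fun k => hT.measurable.iterate k hB,
    ⋃ i ∈ Finset.range m, T^[i] ⁻¹' B, ?_, ?_⟩
  · calc μ (⋃ i ∈ Finset.range m, T^[i] ⁻¹' B)
        ≤ ∑ i ∈ Finset.range m, μ (T^[i] ⁻¹' B) := measure_biUnion_finset_le _ _
      _ = m * μ B := by
          rw [Finset.sum_congr rfl fun i _ =>
            (hT.iterate i).measure_preimage hB.nullMeasurableSet]
          simp
      _ ≤ ε := by
          have hm : (m : ℝ≥0∞) ≤ ε * n := by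
            rcases eq_or_ne ε ⊤ with rfl | hε'
            · have : (n : ℝ≥0∞) ≠ 0 := (bot_le.trans_lt hn).ne'
              rw [ENNReal.top_mul this]; exact le_top
            · rw [mul_comm]; exact (ENNReal.div_le_iff hε hε').mp hn.le
          calc m * μ B ≤ ε * n * μ B := by gcongr
            _ = ε * (n * μ B) := mul_assoc _ _ _
            _ ≤ ε * 1 := by
                gcongr
                exact (mul_le_mul_left le_self_add _).trans hμB
            _ = ε := mul_one _
  · intro x hx i hi
    simp only [Set.mem_iUnion, Finset.mem_range, Set.mem_preimage, not_exists] at hx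
    have h1 : i ≤ Nat.find (hhit x) := by
      rw [Nat.le_find_iff]
      exact fun k hk => hx k (by omega)
    have h2 : Nat.find (hhit (T^[i] x)) = Nat.find (hhit x) - i := by
      rw [Nat.find_eq_iff]
      constructor
      · rw [← Function.iterate_add_apply, Nat.sub_add_cancel h1]
        exact Nat.find_spec (hhit x)
      · intro k hk
        rw [← Function.iterate_add_apply]
        exact Nat.find_min (hhit x) (by omega)
    simp only [h2]
    omega

/-! ### Factorial multiples on the circle -/

lemma UnitAddCircle.norm_coe_le (r : ℝ) : ‖(r : UnitAddCircle)‖ ≤ |r| := by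
  rw [UnitAddCircle.norm_eq]
  simpa using round_le r 0

/-- The sequence of factorials is so lacunary that the multiples `n! • α` of a suitable `α` follow
any prescribed sequence in the circle. -/
lemma exists_factorial_nsmul_approx (θ : ℕ → UnitAddCircle) (N : ℕ) :
    ∃ α : UnitAddCircle, ∀ n, 1 ≤ n → n ≤ N →
      ‖n.factorial • α - θ n‖ ≤ 1 / (2 * n) := by
  -- The factor `1 - n! / N!` reserves room for the corrections made at later stages.
  suffices h : ∃ α : UnitAddCircle, ∀ n, 1 ≤ n → n ≤ N →
      ‖n.factorial • α - θ n‖ ≤ 1 / (2 * n) * (1 - n.factorial / N.factorial) by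
    obtain ⟨α, hα⟩ := h
    refine ⟨α, fun n h1 h2 => (hα n h1 h2).trans ?_⟩
    have : (0 : ℝ) ≤ n.factorial / N.factorial := by positivity
    exact mul_le_of_le_one_right (by positivity) (by linarith)
  induction N with
  | zero => exact ⟨0, fun n h1 h2 => by omega⟩
  | succ N ih =>
    obtain ⟨α, hα⟩ := ih
    obtain ⟨s, hs⟩ := QuotientAddGroup.mk_surjective (θ (N + 1) - (N + 1).factorial • α)
    obtain ⟨s, hs, hs2⟩ : ∃ s : ℝ, (s : UnitAddCircle) = θ (N + 1) - (N + 1).factorial • α ∧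
        |s| ≤ 1 / 2 := by
      refine ⟨s - round s, ?_, abs_sub_round s⟩
      rw [← hs]
      have : ((round s : ℝ) : UnitAddCircle) = 0 :=
        (AddCircle.coe_eq_zero_iff 1).mpr ⟨round s, by simp⟩
      rw [AddCircle.coe_sub, this, sub_zero]
    -- This correction makes the case `N + 1` exact and moves each earlier `n! • α` by at most `n! /
    -- (2 * (N + 1)!)`.
    refine ⟨α + ((s / (N + 1).factorial : ℝ) : UnitAddCircle), fun n h1 h2 => ?_⟩
    have hmul : ∀ k : ℕ, k • ((s / (N + 1).factorial : ℝ) : UnitAddCircle) =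
        ((k * (s / (N + 1).factorial) : ℝ) : UnitAddCircle) := fun k => by
      rw [← AddCircle.coe_nsmul, nsmul_eq_mul]
    have hF : (0 : ℝ) < (N + 1).factorial := by positivity
    rw [smul_add, hmul]
    rcases Nat.le_succ_iff.mp h2 with h | rfl
    · have hN : (1 : ℝ) ≤ N := by exact_mod_cast h1.trans h
      have hn : (1 : ℝ) ≤ n := by exact_mod_cast h1
      have hnN : (n : ℝ) ≤ N := by exact_mod_cast h
      have hNf : (0 : ℝ) < N.factorial := by positivity
      have hnf : (0 : ℝ) < n.factorial := by positivity
      have e1 : ‖((n.factorial * (s / (N + 1).factorial) : ℝ) : UnitAddCircle)‖ ≤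
          n.factorial / (N + 1).factorial * (1 / 2) := by
        refine (UnitAddCircle.norm_coe_le _).trans ?_
        rw [abs_mul, abs_div, abs_of_pos hnf, abs_of_pos hF, ← mul_div_assoc, div_mul_eq_mul_div]
        gcongr
      calc ‖n.factorial • α + ((n.factorial * (s / (N + 1).factorial) : ℝ) : UnitAddCircle) - θ n‖
          = ‖(n.factorial • α - θ n) +
              ((n.factorial * (s / (N + 1).factorial) : ℝ) : UnitAddCircle)‖ := by
            congr 1; abel
        _ ≤ 1 / (2 * n) * (1 - n.factorial / N.factorial) +
              n.factorial / (N + 1).factorial * (1 / 2) :=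
            (norm_add_le _ _).trans (add_le_add (hα n h1 h) e1)
        _ ≤ 1 / (2 * n) * (1 - n.factorial / (N + 1).factorial) := by
            rw [← sub_nonneg]
            have : (((N + 1).factorial : ℕ) : ℝ) = (N + 1) * N.factorial := by
              rw [Nat.factorial_succ]; push_cast; ring
            rw [this]
            have e : 1 / (2 * (n : ℝ)) * (1 - n.factorial / ((N + 1) * N.factorial)) -
                (1 / (2 * n) * (1 - n.factorial / N.factorial) +
                  n.factorial / ((N + 1) * N.factorial) * (1 / 2)) =
                n.factorial * (N - n) / (2 * n * ((N + 1) * N.factorial)) := by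
              field_simp
              ring
            rw [e]
            exact div_nonneg (mul_nonneg hnf.le (by linarith)) (by positivity)
    · rw [mul_div_cancel₀ _ hF.ne', hs]
      simp [div_self hF.ne']

/-! ### Block lengths from the divergence of the weight constant -/

/-- The weights can be distributed over blocks in such a way that the block lengths `r t` are
adapted to the weights `w t`, while their total is large compared with the level `y`. -/
lemma exists_block_lengths {p : ℝ} (hp : 1 ≤ p) {w : ℕ → ℝ} (hw : ∀ t, 0 < w t)
    (hC : weightConst p w = ⊤) (K : ℝ) :
    ∃ y : ℝ, 0 < y ∧ ∃ (S : Finset ℕ) (r : ℕ → ℕ), (∀ t ∈ S, 1 ≤ t ∧ 1 ≤ r t ∧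
      r t ≤ 2 ^ (t - 1) ∧ r t * y ≤ 2 * w t) ∧ K ≤ y ^ p * ∑ t ∈ S, (r t : ℝ) := by
  classical
  rcases eq_or_ne p 1 with rfl | hp1
  · rw [weightConst, if_pos rfl, iSup_eq_top] at hC
    obtain ⟨y, hy⟩ := hC (ENNReal.ofReal (2 * K)) ENNReal.ofReal_lt_top
    rw [ENNReal.tsum_eq_iSup_sum, lt_iSup_iff] at hy
    obtain ⟨S₀, hS⟩ := hy
    rw [← Finset.sum_filter] at hS
    set S := S₀.filter fun t => (y : ℝ) < w t ∧ w t < 2 ^ t * (y : ℝ) with hSdef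
    rw [← ENNReal.ofReal_sum_of_nonneg fun t _ => (hw t).le] at hS
    have hS' := (ENNReal.ofReal_lt_ofReal_iff'.mp hS).1
    have hmem : ∀ t ∈ S, (y : ℝ) < w t ∧ w t < 2 ^ t * (y : ℝ) := fun t ht =>
      (Finset.mem_filter.mp ht).2
    have hypos : S.Nonempty → (0 : ℝ) < y := by
      rintro ⟨t, ht⟩
      have h := (hw t).trans (hmem t ht).2
      exact pos_of_mul_pos_right h (by positivity)
    rcases S.eq_empty_or_nonempty with hemp | hne
    · refine ⟨1, one_pos, ∅, 0, by simp, ?_⟩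
      rw [hemp] at hS'
      simp only [Finset.sum_empty] at hS'
      simp only [Finset.sum_empty, mul_zero]
      linarith
    have hy0 := hypos hne
    -- `w t < 2^t * y` keeps the ceiling below `2^(t-1)`, and `y < w t` absorbs its rounding error;
    -- the halving explains the level `2 * K`.
    refine ⟨y, hy0, S, fun t => ⌈w t / (2 * y)⌉₊, fun t ht => ?_, ?_⟩
    · obtain ⟨h1, h2⟩ := hmem t ht
      have ht1 : 1 ≤ t := by
        rcases Nat.eq_zero_or_pos t with rfl | h
        · simp only [pow_zero, one_mul] at h2
          exact absurd (h1.trans h2) (lt_irrefl _)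
        · exact h
      refine ⟨ht1, Nat.one_le_iff_ne_zero.mpr (Nat.ceil_pos.mpr (by have := hw t; positivity)).ne',
        Nat.ceil_le.mpr ?_, ?_⟩
      · rw [div_le_iff₀ (by positivity)]
        push_cast
        have : (2 : ℝ) ^ t = 2 ^ (t - 1) * 2 := by
          rw [← pow_succ, Nat.sub_add_cancel ht1]
        rw [this] at h2
        linarith
      · have h3 := (Nat.ceil_lt_add_one (show 0 ≤ w t / (2 * y) by have := hw t; positivity)).le
        calc (⌈w t / (2 * (y : ℝ))⌉₊ : ℝ) * y ≤ (w t / (2 * y) + 1) * y := by gcongr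
          _ = w t / 2 + y := by field_simp
          _ ≤ 2 * w t := by linarith
    · rw [Real.rpow_one, Finset.mul_sum]
      have h4 : ∀ t ∈ S, w t / 2 ≤ y * (⌈w t / (2 * (y : ℝ))⌉₊ : ℝ) := fun t _ => by
        calc w t / 2 = y * (w t / (2 * y)) := by field_simp
          _ ≤ _ := by gcongr; exact Nat.le_ceil _
      have h5 := Finset.sum_le_sum h4
      rw [← Finset.sum_div] at h5
      linarith
  · have hp0 : 0 < p := by linarith
    rw [weightConst, if_neg hp1, weakLpNorm, iSup_eq_top] at hC
    have hw0 := hw 0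
    -- The term `w 0 ^ p` pays in advance for discarding `t = 0`, whose contribution `y ^ p` is at
    -- most that.
    set b : ℝ := max K 0 + w 0 ^ p with hb
    have hb0 : 0 < b := add_pos_of_nonneg_of_pos (le_max_right _ _) (Real.rpow_pos_of_pos hw0 p)
    obtain ⟨y, hy⟩ := hC (ENNReal.ofReal b ^ (1 / p))
      (ENNReal.rpow_lt_top_of_nonneg (by positivity) ENNReal.ofReal_ne_top)
    have hy0 : 0 < y := by
      rcases eq_or_ne y 0 with rfl | h
      · simp at hy
      · exact pos_iff_ne_zero.mpr h
    have hyR : (0 : ℝ) < y := hy0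
    have hyp : 0 < (y : ℝ) ^ p := Real.rpow_pos_of_pos hyR p
    obtain ⟨S₀, hS₀, hS₀b⟩ : ∃ S₀ : Finset ℕ, (∀ t ∈ S₀, (y : ℝ) ≤ w t) ∧
        b ≤ (y : ℝ) ^ p * S₀.card := by
      have hA : ∀ t, t ∈ {t : ℕ | (y : ℝ≥0∞) ≤ ‖w t‖ₑ} → (y : ℝ) ≤ w t := fun t ht => by
        have h : (y : ℝ≥0∞) ≤ ‖w t‖ₑ := ht
        rw [enorm_eq_nnnorm, ENNReal.coe_le_coe, ← NNReal.coe_le_coe, coe_nnnorm,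
          Real.norm_of_nonneg (hw t).le] at h
        exact h
      rcases Set.finite_or_infinite {t : ℕ | (y : ℝ≥0∞) ≤ ‖w t‖ₑ} with hfin | hinf
      · refine ⟨hfin.toFinset, fun t ht => hA t (hfin.mem_toFinset.mp ht), ?_⟩
        rw [Measure.count_apply_finite _ hfin] at hy
        generalize hfin.toFinset.card = c at hy ⊢
        have h := ENNReal.rpow_lt_rpow hy hp0
        rw [ENNReal.mul_rpow_of_nonneg _ _ hp0.le, ← ENNReal.rpow_mul, ← ENNReal.rpow_mul,
          one_div_mul_cancel hp0.ne', ENNReal.rpow_one, ENNReal.rpow_one,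
          ← ENNReal.ofReal_coe_nnreal, ENNReal.ofReal_rpow_of_pos hyR,
          ← ENNReal.ofReal_natCast, ← ENNReal.ofReal_mul hyp.le] at h
        exact (ENNReal.ofReal_lt_ofReal_iff'.mp h).1.le
      · obtain ⟨m, hm⟩ := exists_nat_ge (b / (y : ℝ) ^ p)
        obtain ⟨S₀, hsub, hcard⟩ := hinf.exists_subset_card_eq m
        refine ⟨S₀, fun t ht => hA t (hsub ht), ?_⟩
        rw [hcard]
        exact (div_le_iff₀' hyp).mp hm
    refine ⟨y, hyR, S₀.erase 0, fun _ => 1, fun t ht => ?_, ?_⟩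
    · obtain ⟨ht0, ht⟩ := Finset.mem_erase.mp ht
      have := hS₀ t ht
      refine ⟨Nat.one_le_iff_ne_zero.mpr ht0, le_rfl, Nat.one_le_two_pow, ?_⟩
      push_cast
      linarith
    · have h1 : K ≤ b - w 0 ^ p := by rw [hb]; simp
      refine h1.trans ?_
      simp only [Nat.cast_one, Finset.sum_const, nsmul_eq_mul, mul_one]
      by_cases h0 : 0 ∈ S₀
      · have h2 : (y : ℝ) ^ p ≤ w 0 ^ p := Real.rpow_le_rpow hyR.le (hS₀ 0 h0) hp0.le
        rw [Finset.cast_card_erase_of_mem h0]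
        linarith
      · have := Real.rpow_pos_of_pos hw0 p
        rw [Finset.erase_eq_of_notMem h0]
        linarith

/-- A refinement of `exists_block_lengths`: the total length is moreover bounded in terms of each
of the scales `2 ^ t` involved. -/
lemma exists_large_block_lengths {p : ℝ} (hp : 1 ≤ p) {w : ℕ → ℝ} (hw : ∀ t, 0 < w t)
    (hC : weightConst p w = ⊤) {K : ℝ} (hK : 0 < K) :
    ∃ y : ℝ, 0 < y ∧ ∃ (S : Finset ℕ) (r : ℕ → ℕ), (∀ t ∈ S, 1 ≤ t ∧ 1 ≤ r t ∧
      r t ≤ 2 ^ (t - 1) ∧ r t * y ≤ 2 * w t ∧ ∑ s ∈ S, r s ≤ 4 * 2 ^ t) ∧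
      0 < ∑ t ∈ S, r t ∧ K ≤ y ^ p * ∑ t ∈ S, (r t : ℝ) := by
  classical
  obtain ⟨y, hy, S, r, hS, hKS⟩ := exists_block_lengths hp hw hC (2 * K)
  have hyp : 0 < y ^ p := Real.rpow_pos_of_pos hy p
  set R := ∑ t ∈ S, r t with hR
  set G := S.filter fun t => R ≤ 4 * 2 ^ t with hG
  have hGS : ∑ t ∈ G, r t ≤ R :=
    Finset.sum_le_sum_of_subset (Finset.filter_subset _ _)
  -- Since `2 * r t ≤ 2^t`, the discarded scales are dominated by a geometric sum ending at the
  -- largest of them, so they carry at most half of `R`.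
  have hsmall : ∑ t ∈ S.filter (fun t => ¬ R ≤ 4 * 2 ^ t), 2 * r t ≤ R := by
    rcases (S.filter fun t => ¬ R ≤ 4 * 2 ^ t).eq_empty_or_nonempty with h | h
    · rw [h]; simp
    · set D := S.filter fun t => ¬ R ≤ 4 * 2 ^ t with hD
      obtain ⟨-, h1⟩ := Finset.mem_filter.mp (D.max'_mem h)
      calc ∑ t ∈ D, 2 * r t ≤ ∑ t ∈ D, 2 ^ t := by
            refine Finset.sum_le_sum fun t ht => ?_
            obtain ⟨h2, -, h3, -⟩ := hS t (Finset.mem_filter.mp ht).1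
            calc 2 * r t ≤ 2 * 2 ^ (t - 1) := by gcongr
              _ = 2 ^ t := by rw [← pow_succ', Nat.sub_add_cancel h2]
        _ ≤ ∑ t ∈ Finset.range (D.max' h + 1), 2 ^ t :=
            Finset.sum_le_sum_of_subset fun t ht =>
              Finset.mem_range.mpr (Nat.lt_succ_of_le (D.le_max' t ht))
        _ ≤ R := by
            rw [Nat.geomSum_eq le_rfl, pow_succ]
            omega
  have hsum : ∑ t ∈ G, r t + ∑ t ∈ S.filter (fun t => ¬ R ≤ 4 * 2 ^ t), r t = R :=
    Finset.sum_filter_add_sum_filter_not S _ _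
  rw [← Finset.mul_sum] at hsmall
  have hhalf : R ≤ 2 * ∑ t ∈ G, r t := by omega
  have hKG : K ≤ y ^ p * ∑ t ∈ G, (r t : ℝ) := by
    have h : (R : ℝ) ≤ 2 * ∑ t ∈ G, (r t : ℝ) := by exact_mod_cast hhalf
    have h' : ∑ t ∈ S, (r t : ℝ) = R := by rw [hR]; push_cast; rfl
    rw [h'] at hKS
    have := mul_le_mul_of_nonneg_left h hyp.le
    linarith
  refine ⟨y, hy, G, r, fun t ht => ?_, ?_, hKG⟩
  · obtain ⟨ht, ht'⟩ := Finset.mem_filter.mp ht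
    obtain ⟨h1, h2, h3, h4⟩ := hS t ht
    exact ⟨h1, h2, h3, h4, hGS.trans ht'⟩
  · have h := pos_of_mul_pos_right (hK.trans_le hKG) hyp.le
    exact_mod_cast h

/-! ### Phases, residue classes and the layout of blocks -/

/-- By averaging over the phase `β`, some translate of a ball has a preimage of at most the
expected measure. -/
lemma exists_phase_measure_le {X : Type*} [MeasurableSpace X] (μ : Measure X)
    [IsProbabilityMeasure μ] {g : X → UnitAddCircle} (hg : Measurable g) (ρ : ℝ) :
    ∃ β : UnitAddCircle, μ {x | g x + β ∈ Metric.closedBall (0 : UnitAddCircle) ρ} ≤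
      ENNReal.ofReal (2 * ρ) := by
  have hA : MeasurableSet {q : X × UnitAddCircle |
      g q.1 + q.2 ∈ Metric.closedBall (0 : UnitAddCircle) ρ} :=
    ((hg.comp measurable_fst).add measurable_snd) Metric.isClosed_closedBall.measurableSet
  have hmeas : Measurable fun β : UnitAddCircle =>
      μ {x | g x + β ∈ Metric.closedBall (0 : UnitAddCircle) ρ} :=
    measurable_measure_prodMk_right hA
  have : IsProbabilityMeasure (volume : Measure UnitAddCircle) := ⟨UnitAddCircle.measure_univ⟩
  obtain ⟨β, hβ⟩ := exists_le_lintegral (μ := (volume : Measure UnitAddCircle)) hmeas.aemeasurable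
  refine ⟨β, hβ.trans ?_⟩
  have h1 := Measure.prod_apply_symm (μ := μ) (ν := (volume : Measure UnitAddCircle)) hA
  have h2 := Measure.prod_apply (μ := μ) (ν := (volume : Measure UnitAddCircle)) hA
  have h3 : ∀ x, (volume : Measure UnitAddCircle) (Prod.mk x ⁻¹' {q : X × UnitAddCircle |
      g q.1 + q.2 ∈ Metric.closedBall (0 : UnitAddCircle) ρ}) ≤ ENNReal.ofReal (2 * ρ) := fun x => by
    calc (volume : Measure UnitAddCircle) ((fun β => g x + β) ⁻¹' Metric.closedBall 0 ρ)
        = volume (Metric.closedBall (0 : UnitAddCircle) ρ) := measure_preimage_add _ _ _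
      _ ≤ ENNReal.ofReal (2 * ρ) := by
          rw [AddCircle.volume_closedBall]
          exact ENNReal.ofReal_le_ofReal (min_le_right _ _)
  calc ∫⁻ β, μ {x | g x + β ∈ Metric.closedBall (0 : UnitAddCircle) ρ}
      = ∫⁻ x, (volume : Measure UnitAddCircle) (Prod.mk x ⁻¹' {q : X × UnitAddCircle |
        g q.1 + q.2 ∈ Metric.closedBall (0 : UnitAddCircle) ρ}) ∂μ := h1.symm.trans h2
    _ ≤ ∫⁻ _, ENNReal.ofReal (2 * ρ) ∂μ := lintegral_mono h3
    _ = ENNReal.ofReal (2 * ρ) := by simp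

/-- Each residue class modulo `r ≤ M` occupies a proportion at least `1 / (2 r)` of `(M, 2 M]`. -/
lemma le_two_mul_mul_card_filter_mod_eq {M r i : ℕ} (hr : 0 < r) (hrM : r ≤ M) (hi : i < r) :
    M ≤ 2 * r * ((Finset.Ioc M (2 * M)).filter fun n => n % r = i).card := by
  have hcard := Nat.Ioc_filter_modEq_card M (2 * M) hr i
  have hfilter : ((Finset.Ioc M (2 * M)).filter fun n => n ≡ i [MOD r]) =
      (Finset.Ioc M (2 * M)).filter fun n => n % r = i :=
    Finset.filter_congr fun n _ => by rw [Nat.ModEq, Nat.mod_eq_of_lt hi]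
  rw [hfilter] at hcard
  set c := ((Finset.Ioc M (2 * M)).filter fun n => n % r = i).card
  have hr' : (0 : ℚ) < r := by exact_mod_cast hr
  have hrM' : (r : ℚ) ≤ M := by exact_mod_cast hrM
  have h1 : (⌊(((2 * M : ℕ) : ℚ) - i) / r⌋ : ℤ) - ⌊((M : ℚ) - i) / r⌋ ≤ c :=
    (le_max_left _ _).trans_eq hcard.symm
  have h2 := Int.sub_one_lt_floor ((((2 * M : ℕ) : ℚ) - i) / r)
  have h3 := Int.floor_le (((M : ℚ) - i) / r)
  have h4 : (((⌊(((2 * M : ℕ) : ℚ) - i) / r⌋ : ℤ) - ⌊((M : ℚ) - i) / r⌋ : ℤ) : ℚ) ≤ c := by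
    exact_mod_cast h1
  push_cast at h2 h4
  have h5 : (M : ℚ) / r - 1 < c := by
    have : ((2 * M : ℚ) - i) / r - (M - i) / r = M / r := by ring
    linarith
  have h6 : (M : ℚ) < (c + 1) * r := by
    rw [← div_lt_iff₀ hr']; linarith
  have h7 : M < (c + 1) * r := by exact_mod_cast h6
  -- Once the class is nonempty, `c + 1 ≤ 2 * c` absorbs the boundary loss.
  have h8 : 1 ≤ c := by
    by_contra h
    have : c = 0 := by omega
    rw [this] at h7
    omega
  calc M ≤ (c + 1) * r := h7.le
    _ ≤ (c + c) * r := by gcongr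
    _ = 2 * r * c := by ring

lemma UnitAddCircle.exists_nat_div_approx (z : UnitAddCircle) {R : ℕ} (hR : 0 < R) :
    ∃ m < R, ‖z - ((m / R : ℝ) : UnitAddCircle)‖ ≤ 1 / R := by
  have hR' : (0 : ℝ) < R := by exact_mod_cast hR
  obtain ⟨s, ⟨hs0, hs1⟩, rfl⟩ : ∃ s : ℝ, s ∈ Set.Ico (0 : ℝ) (0 + 1) ∧ (s : UnitAddCircle) = z := by
    have : z ∈ ((↑) : ℝ → UnitAddCircle) '' Set.Ico (0 : ℝ) (0 + 1) := by
      rw [AddCircle.coe_image_Ico_eq]; trivial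
    exact this
  refine ⟨⌊s * R⌋₊, ?_, ?_⟩
  · rw [Nat.floor_lt (by positivity)]
    nlinarith
  · rw [← AddCircle.coe_sub]
    refine (UnitAddCircle.norm_coe_le _).trans ?_
    have h1 := Nat.floor_le (show 0 ≤ s * R by positivity)
    have h2 := Nat.lt_floor_add_one (s * R)
    have h3 : s - (⌊s * R⌋₊ : ℝ) / R = (s * R - ⌊s * R⌋₊) / R := by field_simp
    rw [h3, abs_of_nonneg (div_nonneg (by linarith) hR'.le)]
    gcongr
    linarith

/-- Blocks of lengths `r t` can be laid out one after the other. -/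
lemma exists_block_layout (S : Finset ℕ) (r : ℕ → ℕ) :
    ∃ pos : ℕ → ℕ → ℕ, ∀ m < ∑ t ∈ S, r t, ∃ t ∈ S, ∃ i < r t, pos t i = m := by
  classical
  induction S using Finset.induction_on with
  | empty => exact ⟨0, by simp⟩
  | insert a S ha ih =>
    obtain ⟨pos, hpos⟩ := ih
    refine ⟨fun t i => if t = a then i else r a + pos t i, fun m hm => ?_⟩
    rw [Finset.sum_insert ha] at hm
    by_cases h : m < r a
    · exact ⟨a, Finset.mem_insert_self _ _, m, h, if_pos rfl⟩
    · obtain ⟨t, ht, i, hi, h'⟩ := hpos (m - r a) (by omega)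
      refine ⟨t, Finset.mem_insert_of_mem ht, i, hi, ?_⟩
      have : t ≠ a := fun e => ha (e ▸ ht)
      simp only [if_neg this]
      omega

/-- If `T ^ n!` moves `x` into `F` whenever `n ∈ (2 ^ (t - 1), 2 ^ t]` lies in a given residue
class modulo `r`, then the average of the indicator of `F` is large at `x`. -/
lemma le_weightedAverage_indicator {X : Type*} {T : X → X} {a : ℕ → ℕ} {w : ℕ → ℝ} {F : Set X}
    {x : X} {t r i : ℕ} {y : ℝ} (hw : 0 < w t) (ht : 1 ≤ t) (hr : 1 ≤ r) (hrt : r ≤ 2 ^ (t - 1))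
    (hi : i < r) (hy : r * y ≤ 2 * w t)
    (hF : ∀ n ∈ Finset.Ioc (2 ^ (t - 1)) (2 ^ t), n % r = i → T^[a n] x ∈ F) :
    y / 8 ≤ weightedAverage T a w (F.indicator 1) t x := by
  classical
  have h2 : 2 ^ t = 2 * 2 ^ (t - 1) := by rw [← pow_succ', Nat.sub_add_cancel ht]
  have hcard := le_two_mul_mul_card_filter_mod_eq hr hrt hi
  rw [← h2] at hcard
  set D := (Finset.Ioc (2 ^ (t - 1)) (2 ^ t)).filter fun n => n % r = i with hD
  have hr' : (0 : ℝ) < r := by exact_mod_cast hr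
  have hsum : (D.card : ℝ) ≤ ∑ n ∈ Finset.Icc 1 (2 ^ t), F.indicator (1 : X → ℝ) (T^[a n] x) := by
    calc (D.card : ℝ) = ∑ n ∈ D, F.indicator (1 : X → ℝ) (T^[a n] x) := by
          rw [Finset.sum_congr rfl fun n hn => Set.indicator_of_mem
            (hF n (Finset.mem_filter.mp hn).1 (Finset.mem_filter.mp hn).2) _]
          simp [hD]
      _ ≤ _ := by
          refine Finset.sum_le_sum_of_subset_of_nonneg (fun n hn => ?_) fun n _ _ =>
            Set.indicator_nonneg (fun _ _ => zero_le_one) _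
          have := Finset.mem_Ioc.mp (Finset.mem_filter.mp hn).1
          exact Finset.mem_Icc.mpr ⟨by omega, this.2⟩
  have hcard' : (2 : ℝ) ^ t ≤ 4 * r * D.card := by
    have h : 2 ^ t ≤ 4 * r * D.card := by
      rw [h2]
      calc 2 * 2 ^ (t - 1) ≤ 2 * (2 * r * D.card) := by gcongr
        _ = 4 * r * D.card := by ring
    exact_mod_cast h
  have hpow : (0 : ℝ) < 2 ^ t := by positivity
  calc y / 8 ≤ w t / (4 * r) := by
        rw [div_le_div_iff₀ (by norm_num) (by positivity)]
        linarith
    _ ≤ w t * ((2 : ℝ) ^ t)⁻¹ * D.card := by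
        rw [mul_assoc, div_eq_mul_inv]
        gcongr
        rw [inv_mul_eq_div, le_div_iff₀ hpow, inv_mul_le_iff₀ (by positivity)]
        exact hcard'
    _ ≤ _ := by
        unfold weightedAverage
        gcongr

/-! ### The set with large averages -/

/-- The main construction: a set `F` for whose indicator the maximal function exceeds `y` outside
a set of small measure, although the measure of `F` is much smaller than `y ^ p`. -/
lemma exists_set_le_weightedAverage {X : Type*} [MeasurableSpace X]
    [MeasurableSpace.CountablySeparated X] {μ : Measure X} [IsProbabilityMeasure μ] {T : X → X}
    (hT : MeasurePreserving T μ μ) (hap : AperiodicTransformation μ T) {p : ℝ} (hp : 1 ≤ p)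
    {w : ℕ → ℝ} (hw : ∀ t, 0 < w t) (hC : weightConst p w = ⊤) {K : ℝ} (hK : 0 < K)
    {ε : ℝ≥0∞} (hε : ε ≠ 0) :
    ∃ F : Set X, MeasurableSet F ∧ ∃ y : ℝ, 0 < y ∧
      ENNReal.ofReal K * μ F ≤ ENNReal.ofReal (y ^ p) ∧ ∃ E : Set X, μ E ≤ ε ∧
        ∀ x ∉ E, ∃ t, y ≤ weightedAverage T (fun n => n.factorial) w (F.indicator 1) t x := by
  have h8 : (0 : ℝ) < 8 ^ p := by positivity
  -- The `10` comes from the measure bound `10 / R`, and `8 ^ p` from replacing `y` by `y / 8`.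
  obtain ⟨y, hy, S, r, hS, hR, hKR⟩ :=
    exists_large_block_lengths hp hw hC (show 0 < 10 * 8 ^ p * K by positivity)
  set R := ∑ t ∈ S, r t with hRdef
  have hR' : (0 : ℝ) < R := by exact_mod_cast hR
  have hRcast : ∑ t ∈ S, (r t : ℝ) = R := by rw [hRdef]; push_cast; rfl
  rw [hRcast] at hKR
  obtain ⟨pos, hpos⟩ := exists_block_layout S r
  -- `Nat.clog 2 n` recovers the scale `t` with `n ∈ (2^(t-1), 2^t]`.
  let θ : ℕ → UnitAddCircle := fun n =>
    ((pos (Nat.clog 2 n) (n % r (Nat.clog 2 n)) / R : ℝ) : UnitAddCircle)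
  set N := 2 ^ S.sup id with hN
  obtain ⟨α, hα⟩ := exists_factorial_nsmul_approx θ N
  obtain ⟨h, hh, E, hE, hcount⟩ := exists_countdown hT hap N.factorial hε
  have hg : Measurable fun x => h x • α := (Measurable.of_discrete (f := fun k : ℕ => k • α)).comp hh
  obtain ⟨β, hβ⟩ := exists_phase_measure_le μ hg (5 / R)
  refine ⟨{x | h x • α + β ∈ Metric.closedBall (0 : UnitAddCircle) (5 / R)},
    (hg.add_const β) Metric.isClosed_closedBall.measurableSet, y / 8, by positivity, ?_,
    E, hE, fun x hx => ?_⟩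
  · calc ENNReal.ofReal K * _ ≤ ENNReal.ofReal K * ENNReal.ofReal (2 * (5 / R)) := by gcongr
      _ = ENNReal.ofReal (K * (2 * (5 / R))) := (ENNReal.ofReal_mul hK.le).symm
      _ ≤ ENNReal.ofReal ((y / 8) ^ p) := by
          refine ENNReal.ofReal_le_ofReal ?_
          rw [Real.div_rpow hy.le (by norm_num), le_div_iff₀ h8,
            show K * (2 * (5 / (R : ℝ))) * 8 ^ p = 10 * 8 ^ p * K / R by ring, div_le_iff₀ hR']
          exact hKR
  · obtain ⟨m, hm, hzm⟩ := UnitAddCircle.exists_nat_div_approx (h x • α + β) hR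
    obtain ⟨t, ht, i, hi, him⟩ := hpos m hm
    obtain ⟨ht1, hr1, hrt, hry, hRt⟩ := hS t ht
    refine ⟨t, le_weightedAverage_indicator (hw t) ht1 hr1 hrt hi hry fun n hn hni => ?_⟩
    obtain ⟨hn1, hn2⟩ := Finset.mem_Ioc.mp hn
    have hclog : Nat.clog 2 n = t := by
      refine le_antisymm (Nat.clog_le_of_le_pow hn2) ?_
      have := (Nat.lt_clog_iff_pow_lt one_lt_two).mpr hn1
      omega
    have hθ : θ n = ((m / R : ℝ) : UnitAddCircle) := by
      simp only [θ, hclog, hni, him]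
    have hnN : n ≤ N := hn2.trans (Nat.pow_le_pow_right two_pos (Finset.le_sup (f := id) ht))
    have hn0 : 1 ≤ n := by omega
    have hα' := hα n hn0 hnN
    rw [hθ] at hα'
    -- Here `R ≤ 4 * 2^t` and `2^(t-1) < n` make the approximation error `1 / (2 * n)` comparable to
    -- an arc.
    have hRn : (R : ℝ) ≤ 4 * (2 * n) := by
      have h1 : R ≤ 4 * (2 * n) := by
        have h2 : 2 ^ t = 2 * 2 ^ (t - 1) := by rw [← pow_succ', Nat.sub_add_cancel ht1]
        omega
      exact_mod_cast h1
    have hn' : (0 : ℝ) < n := by exact_mod_cast hn0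
    have herr : 1 / (2 * (n : ℝ)) ≤ 4 / R := by
      rw [div_le_div_iff₀ (by positivity) hR']
      linarith
    have hx' := hcount x hx n.factorial (Nat.factorial_le hnN)
    rw [Set.mem_ofPred_eq, mem_closedBall_zero_iff]
    calc ‖h (T^[n.factorial] x) • α + β‖
        = ‖(h x • α + β - ((m / R : ℝ) : UnitAddCircle)) -
            (n.factorial • α - ((m / R : ℝ) : UnitAddCircle))‖ := by
          rw [← hx', add_smul]
          congr 1
          abel
      _ ≤ 1 / R + 4 / R := (norm_sub_le _ _).trans (add_le_add hzm (hα'.trans herr))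
      _ = 5 / R := by ring

/-! ### From large averages to divergence -/

/-- A value above the sum of the first `N` absolute values cannot occur before time `N`, so large
values recur arbitrarily late. -/
lemma limsup_coe_eq_top_of_forall_exists_le {u : ℕ → ℝ} (hu : ∀ M : ℝ, ∃ t, M ≤ u t) :
    limsup (fun t => (u t : EReal)) atTop = ⊤ := by
  rw [EReal.eq_top_iff_forall_lt]
  intro M
  refine lt_of_lt_of_le (b := ((M + 1 : ℝ) : EReal)) (by exact_mod_cast lt_add_one M) ?_
  refine le_limsup_of_frequently_le ?_ (by isBoundedDefault)
  rw [frequently_atTop]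
  intro N
  obtain ⟨t, ht⟩ := hu (max (M + 1) (∑ s ∈ Finset.range N, |u s| + 1))
  refine ⟨t, ?_, by exact_mod_cast (le_max_left _ _).trans ht⟩
  by_contra! h
  have h1 := Finset.single_le_sum (f := fun s => |u s|) (fun s _ => abs_nonneg _)
    (Finset.mem_range.mpr h)
  have h2 := (le_max_right _ _).trans ht
  have h3 := le_abs_self (u t)
  linarith

lemma weightedAverage_mono {X : Type*} {T : X → X} {a : ℕ → ℕ} {w : ℕ → ℝ} {f g : X → ℝ} {t : ℕ}
    {x : X} (hw : 0 ≤ w t) (h : ∀ n, f (T^[a n] x) ≤ g (T^[a n] x)) :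
    weightedAverage T a w f t x ≤ weightedAverage T a w g t x := by
  unfold weightedAverage
  gcongr
  exact h _

lemma weightedAverage_const_mul {X : Type*} (T : X → X) (a : ℕ → ℕ) (w : ℕ → ℝ) (f : X → ℝ)
    (t : ℕ) (x : X) (c : ℝ) :
    weightedAverage T a w (fun x => c * f x) t x = c * weightedAverage T a w f t x := by
  unfold weightedAverage
  rw [← Finset.mul_sum]
  ring

/-- Superposition of sets for which the maximal function is large gives a function with almost
everywhere divergent averages. -/
lemma exists_divergesAE {X : Type*} [MeasurableSpace X] {μ : Measure X} {T : X → X}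
    (hT : MeasurePreserving T μ μ) {a : ℕ → ℕ} {p : ℝ} (hp : 1 ≤ p) {w : ℕ → ℝ}
    (hw : ∀ t, 0 < w t)
    (H : ∀ K : ℝ, 0 < K → ∀ ε : ℝ≥0∞, ε ≠ 0 → ∃ F : Set X, MeasurableSet F ∧ ∃ y : ℝ, 0 < y ∧
      ENNReal.ofReal K * μ F ≤ ENNReal.ofReal (y ^ p) ∧ ∃ E : Set X, μ E ≤ ε ∧
        ∀ x ∉ E, ∃ t, y ≤ weightedAverage T a w (F.indicator 1) t x) :
    ∃ f : X → ℝ, MemLp f (ENNReal.ofReal p) μ ∧ DivergesAE μ T a w f := by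
  have hp0 : 0 < p := by linarith
  have hgeom : ∑' k : ℕ, (2⁻¹ : ℝ≥0∞) ^ k ≠ ⊤ := by
    rw [ENNReal.tsum_geometric, ENNReal.one_sub_inv_two, inv_inv]
    exact ENNReal.ofNat_ne_top
  -- With `c k = (k + 1) / y k`, this choice of `K` gives `c k ^ p * μ (F k) ≤ 2^(-k)`.
  choose F hF y hy hFy E hE hEF using fun k : ℕ =>
    H ((k + 1) ^ p * 2 ^ k) (by positivity) ((2⁻¹ : ℝ≥0∞) ^ k)
      (pow_ne_zero _ (ENNReal.inv_ne_zero.mpr ENNReal.ofNat_ne_top))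
  set c : ℕ → ℝ := fun k => (k + 1) / y k with hc
  have hc0 : ∀ k, 0 < c k := fun k => div_pos (by positivity) (hy k)
  set G : X → ℝ≥0∞ := fun x =>
    ∑' k, (F k).indicator (fun _ => ENNReal.ofReal (c k ^ p)) x with hG
  have hGm : Measurable G :=
    Measurable.tsum fun k => measurable_const.indicator (hF k)
  have hGint : ∫⁻ x, G x ∂μ ≠ ⊤ := by
    rw [lintegral_tsum fun k => (measurable_const.indicator (hF k)).aemeasurable]
    refine ne_top_of_le_ne_top hgeom (ENNReal.tsum_le_tsum fun k => ?_)
    rw [lintegral_indicator_const (hF k)]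
    have hyp := Real.rpow_pos_of_pos (hy k) p
    have hkp : (0 : ℝ) < (k + 1) ^ p := by positivity
    have e : c k ^ p = (2⁻¹) ^ k * (y k ^ p)⁻¹ * ((k + 1) ^ p * 2 ^ k) := by
      rw [hc, Real.div_rpow (by positivity) (hy k).le]
      field_simp
      rw [← mul_pow]
      norm_num
    calc ENNReal.ofReal (c k ^ p) * μ (F k)
        = ENNReal.ofReal ((2⁻¹) ^ k * (y k ^ p)⁻¹) *
            (ENNReal.ofReal ((k + 1) ^ p * 2 ^ k) * μ (F k)) := by
          rw [e, ENNReal.ofReal_mul (by positivity), mul_assoc]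
      _ ≤ ENNReal.ofReal ((2⁻¹) ^ k * (y k ^ p)⁻¹) * ENNReal.ofReal (y k ^ p) :=
          mul_le_mul_right (hFy k) _
      _ = (2⁻¹ : ℝ≥0∞) ^ k := by
          rw [← ENNReal.ofReal_mul (by positivity), inv_mul_cancel_right₀ hyp.ne',
            ENNReal.ofReal_pow (by norm_num), ENNReal.ofReal_inv_of_pos two_pos,
            ENNReal.ofReal_ofNat]
  set f : X → ℝ := fun x => (G x).toReal ^ (1 / p) with hf
  refine ⟨f, ⟨?_, ?_⟩, ?_⟩
  · exact (hGm.ennreal_toReal.pow_const _).aestronglyMeasurable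
  · rw [eLpNorm_lt_top_iff_lintegral_rpow_enorm_lt_top (by simpa using hp0)
      ENNReal.ofReal_ne_top, ENNReal.toReal_ofReal hp0.le]
    refine lt_of_le_of_lt (lintegral_mono fun x => ?_) hGint.lt_top
    have h0 : 0 ≤ f x := by positivity
    rw [Real.enorm_eq_ofReal h0, ENNReal.ofReal_rpow_of_nonneg h0 hp0.le, hf,
      ← Real.rpow_mul ENNReal.toReal_nonneg, one_div_mul_cancel hp0.ne', Real.rpow_one]
    exact ENNReal.ofReal_toReal_le
  -- Finiteness of `G` is needed along the orbit because `toReal` sends `⊤` to `0`, which would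
  -- destroy `f ≥ c k` on `F k`.
  · have hfin : ∀ᵐ x ∂μ, ∀ n, G (T^[n] x) < ⊤ := by
      rw [ae_all_iff]
      exact fun n => (hT.iterate n).quasiMeasurePreserving.ae (ae_lt_top hGm hGint)
    -- Borel–Cantelli: almost every point escapes all but finitely many exceptional sets.
    have hev : ∀ᵐ x ∂μ, ∀ᶠ k in atTop, x ∉ E k :=
      ae_eventually_notMem (ne_top_of_le_ne_top hgeom (ENNReal.tsum_le_tsum hE))
    filter_upwards [hfin, hev] with x hx hxE
    refine limsup_coe_eq_top_of_forall_exists_le fun M => ?_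
    obtain ⟨k, hkE, hkM⟩ := (hxE.and (eventually_ge_atTop ⌈M⌉₊)).exists
    obtain ⟨t, ht⟩ := hEF k x hkE
    refine ⟨t, ?_⟩
    calc M ≤ k + 1 := by
          have := (Nat.le_ceil M).trans (Nat.cast_le.mpr hkM)
          linarith
      _ = c k * y k := (div_mul_cancel₀ _ (hy k).ne').symm
      _ ≤ c k * weightedAverage T a w ((F k).indicator 1) t x :=
          mul_le_mul_of_nonneg_left ht (hc0 k).le
      _ = weightedAverage T a w (fun x => c k * (F k).indicator 1 x) t x :=
          (weightedAverage_const_mul _ _ _ _ _ _ _).symm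
      _ ≤ weightedAverage T a w f t x := by
          refine weightedAverage_mono (hw t).le fun n => ?_
          by_cases hmem : T^[a n] x ∈ F k
          · rw [Set.indicator_of_mem hmem, Pi.one_apply, mul_one]
            have hle : ENNReal.ofReal (c k ^ p) ≤ G (T^[a n] x) := by
              refine le_trans ?_ (ENNReal.le_tsum k)
              rw [Set.indicator_of_mem hmem]
            have hle' := (ENNReal.ofReal_le_iff_le_toReal (hx (a n)).ne).mp hle
            calc c k = (c k ^ p) ^ (1 / p) := by
                  rw [← Real.rpow_mul (hc0 k).le, mul_one_div_cancel hp0.ne', Real.rpow_one]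
              _ ≤ f (T^[a n] x) := by
                  have := hc0 k
                  exact Real.rpow_le_rpow (by positivity) hle' (by positivity)
          · rw [Set.indicator_of_notMem hmem, mul_zero]
            positivity

/-- Almost everywhere divergence to `+∞` for a single function excludes a weak maximal inequality. -/
lemma not_satisfiesWeakMaximalInequality_of_divergesAE {X : Type*} [MeasurableSpace X]
    {μ : Measure X} [IsProbabilityMeasure μ] {T : X → X} {a : ℕ → ℕ} {p : ℝ} {w : ℕ → ℝ}
    {f : X → ℝ} (hf : MemLp f (ENNReal.ofReal p) μ) (hdiv : DivergesAE μ T a w f) :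
    ¬ SatisfiesWeakMaximalInequality μ T a w p := by
  rintro ⟨C, -, hC⟩
  have hfin : (C : ℝ≥0∞) * eLpNorm f (ENNReal.ofReal p) μ < ⊤ :=
    ENNReal.mul_lt_top ENNReal.coe_lt_top hf.2
  refine (lt_of_le_of_lt (hC f hf) hfin).ne (ENNReal.eq_top_of_forall_nnreal_le fun y => ?_)
  refine le_trans ?_ (le_iSup _ y)
  have h1 : μ {x | (y : ℝ≥0∞) ≤ (maximalFunction T a w f x).abs} = 1 := by
    rw [← measure_univ (μ := μ)]
    refine measure_congr (eventuallyEq_univ.mpr ?_)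
    filter_upwards [hdiv] with x hx
    have : maximalFunction T a w f x = ⊤ := top_le_iff.mp (hx ▸ limsup_le_iSup)
    change (y : ℝ≥0∞) ≤ (maximalFunction T a w f x).abs
    rw [this, EReal.abs_top]
    exact le_top
  rw [h1, ENNReal.one_rpow, mul_one]

theorem mainTheorem5 {X : Type*} [MeasurableSpace X] [MeasurableSpace.CountablySeparated X]
    (μ : Measure X) [IsProbabilityMeasure μ]
    (T : X → X) (hT : MeasurePreserving T μ μ) (hap : AperiodicTransformation μ T)
    (p : ℝ) (hp : 1 ≤ p) (w : ℕ → ℝ) (hw : ∀ t, 0 < w t) (hC : weightConst p w = ⊤) :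
    (∃ a : ℕ → ℕ, ¬ SatisfiesWeakMaximalInequality μ T a w p ∧
      ∃ f : X → ℝ, MemLp f (ENNReal.ofReal p) μ ∧ DivergesAE μ T a w f) ∧
    (¬ SatisfiesWeakMaximalInequality μ T (fun n => n.factorial) w p ∧
      ∃ f : X → ℝ, MemLp f (ENNReal.ofReal p) μ ∧ DivergesAE μ T (fun n => n.factorial) w f) := by
  obtain ⟨f, hf, hdiv⟩ := exists_divergesAE hT hp hw fun _ hK _ hε =>
    exists_set_le_weightedAverage hT hap hp hw hC hK hε
  have hneg := not_satisfiesWeakMaximalInequality_of_divergesAE hf hdiv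
  exact ⟨⟨_, hneg, f, hf, hdiv⟩, hneg, f, hf, hdiv⟩
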